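/- Let $\mathcal{O}\subset\mathbb{R}^2$ be a bounded open set with smooth boundary (that is, near each boundary point, in suitable orthonormal coordinates, $\mathcal{O}$ is the region strictly above the graph of a $C^\infty$ function); in particular, $\mathcal{O}$ may be any smooth bounded domain. Let $H^1(\mathcal{O})$ be the space of real functions $v\in L^2(\mathcal{O})$ with weak gradient $\nabla v\in L^2(\mathcal{O};\mathbb{R}^2)$, with norm $\|v\|_{H^1(\mathcal{O})}=\big(\|v\|_{L^2(\mathcal{O})}^2+\|\nabla v\|_{L^2(\mathcal{O})}^2\big)^{1/2}$, and let $H^1(\mathcal{O})'$ be its dual with the dual norm; each $\xi\in L^2(\mathcal{O})$ is identified with the functional $v\mapsto\int_{\mathcal{O}}\xi v\,dx$ in $H^1(\mathcal{O})'$. Then there exists a constant $c>0$, depending only on $\mathcal{O}$, such that $$\|\xi\|_{H^1(\mathcal{O})'}\le c\Big(1+\|\xi\|_{L^1(\mathcal{O})}\,\log^{1/2}\big(e+\|\xi\|_{L^2(\mathcal{O})}\big)\Big)\qquad\text{for all }\xi\in L^2(\mathcal{O}).$$ -/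

import Mathlib

open MeasureTheory

noncomputable section

/-- The Euclidean plane `ℝ²`. -/
abbrev Plane : Type := EuclideanSpace ℝ (Fin 2)

/-- A bounded open subset of the plane with smooth boundary: around each boundary point `x₀`, in
suitable orthonormal coordinates `y = e x`, the set is the part of a small ball that lies strictly
above the graph `y₁ = γ y₀` of a `C^∞` function `γ`. Connectedness is not required. -/
structure IsSmoothBoundedOpen (O : Set Plane) : Prop where
  isOpen : IsOpen O
  isBounded : Bornology.IsBounded O
  smooth_boundary : ∀ x₀ ∈ frontier O, ∃ (e : Plane ≃ₗᵢ[ℝ] Plane) (γ : ℝ → ℝ) (r : ℝ),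
    ContDiff ℝ ((⊤ : ℕ∞) : WithTop ℕ∞) γ ∧ 0 < r ∧
      ∀ x ∈ Metric.ball x₀ r, x ∈ O ↔ γ (e x 0) < e x 1

/-- Test functions: `φ ∈ C_c^∞(O)`, extended by zero to the plane. -/
structure IsTestFunction (O : Set Plane) (φ : Plane → ℝ) : Prop where
  contDiff : ContDiff ℝ ((⊤ : ℕ∞) : WithTop ℕ∞) φ
  hasCompactSupport : HasCompactSupport φ
  tsupport_subset : tsupport φ ⊆ O

/-- The partial derivative `∂ᵢ φ`. -/
def partialDeriv (i : Fin 2) (φ : Plane → ℝ) (x : Plane) : ℝ :=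
  fderiv ℝ φ x (EuclideanSpace.single i 1)

/-- `g` is the weak gradient of `v` on `O`. -/
def IsWeakGradient (O : Set Plane) (v : Plane → ℝ) (g : Plane → Plane) : Prop :=
  ∀ φ : Plane → ℝ, IsTestFunction O φ → ∀ i : Fin 2,
    ∫ x in O, v x * partialDeriv i φ x = - ∫ x in O, g x i * φ x

/-- The real space `L²(O)`. -/
abbrev L2 (O : Set Plane) : Type := Lp ℝ 2 (volume.restrict O)

/-- The space `L²(O; ℝ²)`. -/
abbrev L2Vec (O : Set Plane) : Type := Lp Plane 2 (volume.restrict O)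

lemma IsTestFunction.memLp {O : Set Plane} {φ : Plane → ℝ} (h : IsTestFunction O φ) :
    MemLp φ 2 (volume.restrict O) :=
  (h.contDiff.continuous.memLp_of_hasCompactSupport h.hasCompactSupport).restrict O

lemma IsTestFunction.memLp_partialDeriv {O : Set Plane} {φ : Plane → ℝ}
    (h : IsTestFunction O φ) (i : Fin 2) :
    MemLp (partialDeriv i φ) 2 (volume.restrict O) := by
  have hc : Continuous (partialDeriv i φ) :=
    (h.contDiff.continuous_fderiv (by simp)).clm_apply continuous_const
  have hs : HasCompactSupport (partialDeriv i φ) :=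
    h.hasCompactSupport.fderiv_apply (𝕜 := ℝ) (EuclideanSpace.single i 1)
  exact (hc.memLp_of_hasCompactSupport hs).restrict O

lemma L2Vec.memLp_coord {O : Set Plane} (g : L2Vec O) (i : Fin 2) :
    MemLp (fun x => g x i) 2 (volume.restrict O) :=
  (Lp.memLp g).continuousLinearMap_comp (EuclideanSpace.proj (𝕜 := ℝ) i)

/-- The Sobolev space `H¹(O)`, realised as the set of pairs `(v, ∇v)` with `v ∈ L²(O)` and weak
gradient `∇v ∈ L²(O; ℝ²)`. Its norm, inherited from the `ℓ²`-product, is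
`(‖v‖² + ‖∇v‖²)^(1/2)`. -/
def H1 (O : Set Plane) : Submodule ℝ (WithLp 2 (L2 O × L2Vec O)) where
  carrier := {p | IsWeakGradient O p.fst p.snd}
  zero_mem' := by
    intro φ hφ i
    have h1 : ∫ x in O, (0 : L2 O) x * partialDeriv i φ x = 0 := by
      refine integral_eq_zero_of_ae ?_
      filter_upwards [Lp.coeFn_zero ℝ 2 (volume.restrict O)] with x hx
      rw [hx]
      simp
    have h2 : ∫ x in O, (0 : L2Vec O) x i * φ x = 0 := by
      refine integral_eq_zero_of_ae ?_
      filter_upwards [Lp.coeFn_zero Plane 2 (volume.restrict O)] with x hx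
      rw [hx]
      simp
    rw [WithLp.zero_fst, WithLp.zero_snd, h1, h2, neg_zero]
  add_mem' := by
    intro p q hp hq φ hφ i
    have e1 : ∫ x in O, (p.fst + q.fst) x * partialDeriv i φ x
        = ∫ x in O, (p.fst x * partialDeriv i φ x + q.fst x * partialDeriv i φ x) := by
      refine integral_congr_ae ?_
      filter_upwards [Lp.coeFn_add p.fst q.fst] with x hx
      rw [hx]
      simp [add_mul]
    have e2 : ∫ x in O, (p.snd + q.snd) x i * φ x
        = ∫ x in O, (p.snd x i * φ x + q.snd x i * φ x) := by
      refine integral_congr_ae ?_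
      filter_upwards [Lp.coeFn_add p.snd q.snd] with x hx
      rw [hx]
      simp [add_mul]
    have i1 : ∀ u : L2 O, Integrable (fun x => u x * partialDeriv i φ x) (volume.restrict O) :=
      fun u => (Lp.memLp u).integrable_mul (hφ.memLp_partialDeriv i)
    have i2 : ∀ g : L2Vec O, Integrable (fun x => g x i * φ x) (volume.restrict O) :=
      fun g => (L2Vec.memLp_coord g i).integrable_mul hφ.memLp
    rw [WithLp.add_fst, WithLp.add_snd, e1, e2, integral_add (i1 _) (i1 _),
      integral_add (i2 _) (i2 _), hp φ hφ i, hq φ hφ i]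
    ring
  smul_mem' := by
    intro a p hp φ hφ i
    have e1 : ∫ x in O, (a • p.fst) x * partialDeriv i φ x
        = a * ∫ x in O, p.fst x * partialDeriv i φ x := by
      rw [← integral_const_mul]
      refine integral_congr_ae ?_
      filter_upwards [Lp.coeFn_smul a p.fst] with x hx
      rw [hx]
      simp [mul_assoc]
    have e2 : ∫ x in O, (a • p.snd) x i * φ x = a * ∫ x in O, p.snd x i * φ x := by
      rw [← integral_const_mul]
      refine integral_congr_ae ?_
      filter_upwards [Lp.coeFn_smul a p.snd] with x hx
      rw [hx]
      simp [mul_assoc]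
    rw [WithLp.smul_fst, WithLp.smul_snd, e1, e2, hp φ hφ i]
    ring

/-- The continuous inclusion `H¹(O) → L²(O)`, `v ↦ v`. -/
def H1.toL2 (O : Set Plane) : H1 O →L[ℝ] L2 O :=
  (ContinuousLinearMap.fst ℝ (L2 O) (L2Vec O)).comp
    ((WithLp.prodContinuousLinearEquiv 2 ℝ (L2 O) (L2Vec O)).toContinuousLinearMap.comp
      (H1 O).subtypeL)

/-- The element `v ↦ (ξ, v)_{L²(O)}` of the dual `H¹(O)'` given by `ξ ∈ L²(O)`. -/
def L2.toH1Dual {O : Set Plane} (ξ : L2 O) : StrongDual ℝ (H1 O) :=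
  (innerSL ℝ ξ).comp (H1.toL2 O)

end

/-! In two dimensions `H¹` just fails to embed in `L^∞`, and the failure is only a square root of a
logarithm once scales below some `δ` are cut off. By duality it suffices to bound `∫ |ξ||v|` by the
`H¹` norm of `v`.

Near each point of the closure the smooth boundary gives a cone of admissible directions: a ball `B`
of vectors `y`, away from the origin, such that all segments from `x` to `x + y` stay in `O`
(`IsSmoothBoundedOpen.exists_cone`). Along them `v(x) = v(x + y) - ∫₀¹ ∇v(x + ty)·y dt` for almost
every `x` (`IsWeakGradient.ae_add_sub_eq`). Multiply by `|ξ|` and average over `y ∈ B`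
(`exists_le_of_forall_ball_le`). The endpoint term costs `‖ξ‖_{L¹}‖v‖_{L²}`.

The gradient term is split at `t = δ`. For `t > δ`, Cauchy–Schwarz in `(t, y)` with weight `t`
gives, for every `x`, a bound `log^{1/2}(1/δ) ‖∇v‖_{L²}`, which is paired with `‖ξ‖_{L¹}`. For `t ≤
δ`, Cauchy–Schwarz in `x` gives `δ ‖ξ‖_{L²}‖∇v‖_{L²}`. Taking `δ = 1/(e + ‖ξ‖_{L²})` makes the
latter at most `‖∇v‖_{L²}`, which accounts for the `1` in the estimate. Compactness of the closure
makes the constant uniform. -/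

open scoped ENNReal

/-! ### Interior cones from the boundary charts. -/

/-- A bounded open set with smooth boundary satisfies, near each point of its closure, a uniform
interior cone condition. -/
lemma IsSmoothBoundedOpen.exists_cone {O : Set Plane} (hO : IsSmoothBoundedOpen O)
    {x₀ : Plane} (hx₀ : x₀ ∈ closure O) :
    ∃ (ρ : ℝ) (p : Plane) (b : ℝ), 0 < ρ ∧ 0 < b ∧ b < ‖p‖ ∧
      ∀ x ∈ O ∩ Metric.ball x₀ ρ, ∀ y ∈ Metric.ball p b, ∀ t ∈ Set.Icc (0 : ℝ) 1,
        x + t • y ∈ O := by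
  have tri : ∀ {ρ b : ℝ} {p x y : Plane} {t : ℝ}, ‖p‖ + b ≤ ρ → x ∈ Metric.ball x₀ ρ →
      y ∈ Metric.ball p b → t ∈ Set.Icc (0 : ℝ) 1 → ‖x + t • y - x₀‖ < 2 * ρ := by
    intro ρ b p x y t hpb hx hy ht
    have h1 : ‖x - x₀‖ < ρ := by simpa [dist_eq_norm] using hx
    have h2 : ‖y - p‖ < b := by simpa [dist_eq_norm] using hy
    have h3 : ‖y‖ ≤ ρ := by
      have := norm_add_le (y - p) p
      rw [sub_add_cancel] at this
      linarith
    have h4 : ‖t • y‖ ≤ ρ := by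
      rw [norm_smul, Real.norm_of_nonneg ht.1]
      nlinarith [ht.1, ht.2, norm_nonneg y]
    calc ‖x + t • y - x₀‖ = ‖(x - x₀) + t • y‖ := by congr 1; abel
      _ ≤ ‖x - x₀‖ + ‖t • y‖ := norm_add_le _ _
      _ < 2 * ρ := by linarith
  by_cases hx : x₀ ∈ O
  · obtain ⟨r, hr, hrO⟩ := Metric.isOpen_iff.1 hO.isOpen x₀ hx
    obtain ⟨p, hp⟩ := exists_norm_eq Plane (show (0 : ℝ) ≤ r / 4 by positivity)
    refine ⟨r / 2, p, r / 8, by positivity, by positivity, by rw [hp]; linarith, ?_⟩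
    intro x hx y hy t ht
    apply hrO
    rw [Metric.mem_ball, dist_eq_norm]
    have := tri (by rw [hp]; linarith) hx.2 hy ht
    linarith
  · have hfr : x₀ ∈ frontier O := by
      rw [hO.isOpen.frontier_eq]
      exact ⟨hx₀, hx⟩
    obtain ⟨e, γ, r, hγ, hr, hgraph⟩ := hO.smooth_boundary x₀ hfr
    obtain ⟨K, s, hs, hK⟩ := (hγ.of_le (m := 1) (by exact_mod_cast le_top)).contDiffAt
      (x := e x₀ 0) |>.exists_lipschitzOnWith
    obtain ⟨η, hη, hηs⟩ := Metric.mem_nhds_iff.1 hs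
    -- By `tri` the segments stay within `2ρ` of `x₀`; both the graph description and the Lipschitz
    -- bound on `γ` must hold there, hence the halving.
    set ρ := min r η / 2 with hρ
    have hρ0 : 0 < ρ := by positivity
    have hρr : 2 * ρ ≤ r := by rw [hρ]; linarith [min_le_left r η]
    have hρη : 2 * ρ ≤ η := by rw [hρ]; linarith [min_le_right r η]
    set h := ρ / 2 with hh
    -- A direction in the ball has horizontal part below `b` and vertical part above `h - b`. This
    -- `b` makes `K * b ≤ h - b`, so the segment rises at least as fast as the `K`-Lipschitz graph
    -- can.
    set b := h / (2 * (K + 1)) with hb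
    have hK0 : (0 : ℝ) ≤ K := K.2
    have hh0 : 0 < h := by positivity
    have hb0 : 0 < b := by positivity
    have hbK : (K + 1) * b = h / 2 := by rw [hb]; field_simp
    have hbh : b ≤ h / 2 := by nlinarith
    set q : Plane := EuclideanSpace.single 1 h with hq
    have hp : ‖e.symm q‖ = h := by
      rw [LinearIsometryEquiv.norm_map, hq, PiLp.norm_single, Real.norm_of_nonneg hh0.le]
    refine ⟨ρ, e.symm q, b, hρ0, hb0, by rw [hp]; linarith, ?_⟩
    rintro x ⟨hxO, hxb⟩ y hy t ht
    have hxy := tri (by rw [hp]; linarith) hxb hy ht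
    have hxb' : ‖x - x₀‖ < ρ := by simpa [dist_eq_norm] using hxb
    have coord : ∀ (z : Plane) (i : Fin 2), |z i| ≤ ‖z‖ := fun z i => by
      simpa using PiLp.norm_apply_le z i
    have hxr : x ∈ Metric.ball x₀ r := by
      rw [Metric.mem_ball, dist_eq_norm]; linarith
    have hxyr : x + t • y ∈ Metric.ball x₀ r := by
      rw [Metric.mem_ball, dist_eq_norm]; linarith
    rw [hgraph _ hxyr]
    have hxγ := (hgraph x hxr).1 hxO
    have near : ∀ z : Plane, ‖z - x₀‖ < 2 * ρ → e z 0 ∈ s := by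
      intro z hz
      apply hηs
      rw [Metric.mem_ball, Real.dist_eq]
      have := coord (e (z - x₀)) 0
      rw [LinearIsometryEquiv.norm_map, map_sub, PiLp.sub_apply] at this
      linarith
    have hlip := hK.dist_le_mul _ (near _ hxy) _ (near x (by linarith))
    rw [map_add, map_smul] at hlip ⊢
    simp only [PiLp.add_apply, PiLp.smul_apply, smul_eq_mul] at hlip ⊢
    rw [Real.dist_eq, Real.dist_eq, add_sub_cancel_left, abs_mul, abs_of_nonneg ht.1] at hlip
    have hyq : ‖e y - q‖ < b := by
      have : ‖e (y - e.symm q)‖ < b := by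
        rw [LinearIsometryEquiv.norm_map]; simpa [dist_eq_norm] using hy
      simpa using this
    have h0 : |e y 0| < b := by
      have := coord (e y - q) 0
      simp [hq] at this
      linarith
    have h1 : |e y 1 - h| < b := by
      have := coord (e y - q) 1
      simp [hq] at this
      linarith
    have h1' := (abs_lt.1 h1).1
    have h2 := (le_abs_self _).trans hlip
    have h3 : (K : ℝ) * (t * |e y 0|) ≤ t * e y 1 := by
      have : (K : ℝ) * |e y 0| ≤ e y 1 := by nlinarith
      nlinarith [ht.1]
    linarith

/-! ### Weak gradients and the fundamental theorem of calculus on segments. -/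

/-- Translates of a test function are test functions as long as the support stays inside. -/
lemma IsTestFunction.comp_sub {O U : Set Plane} {φ : Plane → ℝ} (h : IsTestFunction U φ)
    {a : Plane} (ha : ∀ x ∈ U, x + a ∈ O) : IsTestFunction O (fun x => φ (x - a)) where
  contDiff := h.contDiff.comp (contDiff_id.sub contDiff_const)
  hasCompactSupport := h.hasCompactSupport.comp_homeomorph (Homeomorph.subRight a)
  tsupport_subset := by
    intro x hx
    have h1 : x - a ∈ tsupport φ :=
      tsupport_comp_subset_preimage φ (f := fun x : Plane => x - a) (by fun_prop) hx
    simpa using ha _ (h.tsupport_subset h1)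

/-- The weak gradient tests against directional derivatives. -/
lemma IsWeakGradient.integral_fderiv {O : Set Plane} {v : Plane → ℝ} {g : Plane → Plane}
    (h : IsWeakGradient O v g) (hv : IntegrableOn v O) (hg : IntegrableOn g O)
    {φ : Plane → ℝ} (hφ : IsTestFunction O φ) (y : Plane) :
    ∫ x in O, v x * fderiv ℝ φ x y = -∫ x in O, inner ℝ (g x) y * φ x := by
  have hφb : ∃ C, ∀ x, ‖φ x‖ ≤ C :=
    hφ.hasCompactSupport.exists_bound_of_continuous hφ.contDiff.continuous
  have hcont : ∀ w : Plane, Continuous (fun x => fderiv ℝ φ x w) := fun w =>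
    (hφ.contDiff.continuous_fderiv (by simp)).clm_apply continuous_const
  have hdb : ∀ w : Plane, ∃ C, ∀ x, ‖fderiv ℝ φ x w‖ ≤ C := fun w =>
    (hφ.hasCompactSupport.fderiv_apply (𝕜 := ℝ) w).exists_bound_of_continuous (hcont w)
  have i1 : ∀ w, Integrable (fun x => v x * fderiv ℝ φ x w) (volume.restrict O) := fun w => by
    obtain ⟨C, hC⟩ := hdb w
    exact hv.mul_bdd (c := C) (hcont w).aestronglyMeasurable (ae_of_all _ hC)
  have i2 : ∀ i : Fin 2, Integrable (fun x => g x i * φ x) (volume.restrict O) := fun i => by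
    obtain ⟨C, hC⟩ := hφb
    exact ((EuclideanSpace.proj (𝕜 := ℝ) i).integrable_comp hg).mul_bdd (c := C)
      hφ.contDiff.continuous.aestronglyMeasurable (ae_of_all _ hC)
  have hy : y = y 0 • EuclideanSpace.single 0 (1 : ℝ) + y 1 • EuclideanSpace.single 1 (1 : ℝ) := by
    ext i
    fin_cases i <;> simp
  have e1 : ∀ x, v x * fderiv ℝ φ x y =
      y 0 * (v x * partialDeriv 0 φ x) + y 1 * (v x * partialDeriv 1 φ x) := by
    intro x
    conv_lhs => rw [hy]
    simp only [map_add, map_smul, smul_eq_mul, partialDeriv]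
    ring
  have e2 : ∀ x, inner ℝ (g x) y * φ x = y 0 * (g x 0 * φ x) + y 1 * (g x 1 * φ x) := by
    intro x
    simp only [PiLp.inner_apply, Fin.sum_univ_two, RCLike.inner_apply, conj_trivial]
    ring
  have i1' : ∀ i, Integrable (fun x => v x * partialDeriv i φ x) (volume.restrict O) :=
    fun i => i1 _
  simp_rw [e1, e2]
  rw [integral_add ((i1' 0).const_mul _) ((i1' 1).const_mul _),
    integral_add ((i2 0).const_mul _) ((i2 1).const_mul _)]
  simp_rw [integral_const_mul]
  rw [h φ hφ 0, h φ hφ 1]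
  ring

/-- For fixed `t` the slice is a translate of `F`, so its `L¹` norm does not depend on `t`. This
justifies exchanging the integrals in `x` and `t`. -/
lemma integrable_comp_add_smul {F : Plane → ℝ} (hF : Integrable F) (hFm : StronglyMeasurable F)
    (y : Plane) :
    Integrable (fun z : Plane × ℝ => F (z.1 + z.2 • y))
      (volume.prod (volume.restrict (Set.Ioc (0 : ℝ) 1))) := by
  have hm : StronglyMeasurable (fun z : Plane × ℝ => F (z.1 + z.2 • y)) :=
    hFm.comp_measurable (by fun_prop : Measurable fun z : Plane × ℝ => z.1 + z.2 • y)
  rw [integrable_prod_iff' hm.aestronglyMeasurable]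
  refine ⟨ae_of_all _ fun t => hF.comp_add_right (t • y), ?_⟩
  simp_rw [fun t : ℝ => integral_add_right_eq_self (μ := volume) (fun x => ‖F x‖) (t • y)]
  exact integrable_const _

/-- The fundamental theorem of calculus along segments for functions with a weak gradient. -/
lemma IsWeakGradient.ae_add_sub_eq {O U : Set Plane} {v : Plane → ℝ} {g : Plane → Plane}
    (h : IsWeakGradient O v g) (hOm : MeasurableSet O)
    (hgm : StronglyMeasurable g)
    (hv : IntegrableOn v O) (hg : IntegrableOn g O) (hU : IsOpen U) {y : Plane}
    (hy : ∀ x ∈ U, ∀ t ∈ Set.Icc (0 : ℝ) 1, x + t • y ∈ O) :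
    ∀ᵐ x : Plane, x ∈ U → O.indicator v (x + y) - O.indicator v x
      - ∫ t in Set.Ioc (0 : ℝ) 1, O.indicator (fun z => inner ℝ (g z) y) (x + t • y) = 0 := by
  set V := O.indicator v with hV
  set G := O.indicator (fun z => inner ℝ (g z) y) with hG
  have hVi : Integrable V := (integrable_indicator_iff hOm).2 hv
  have hGi : Integrable G := (integrable_indicator_iff hOm).2 (hg.inner_const y)
  have hGm : StronglyMeasurable G := (hgm.inner stronglyMeasurable_const).indicator hOm
  have hGp := integrable_comp_add_smul hGi hGm y
  have hI : Integrable (fun x => ∫ t in Set.Ioc (0 : ℝ) 1, G (x + t • y)) := hGp.integral_prod_left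
  -- By the fundamental lemma of the calculus of variations it is enough to test against smooth `φ`
  -- supported in `U`. Translation then moves onto `φ`, where the classical formula `hline` applies.
  refine hU.ae_eq_zero_of_integral_contDiff_smul_eq_zero
    ((((hVi.comp_add_right y).sub hVi).sub hI).locallyIntegrable.locallyIntegrableOn _) ?_
  intro φ hφ hφc hφU
  have hφt : IsTestFunction U φ := ⟨hφ, hφc, hφU⟩
  obtain ⟨C, hC⟩ := hφc.exists_bound_of_continuous hφ.continuous
  have hbd : ∀ {F : Plane → ℝ}, Integrable F → Integrable (fun x => φ x * F x) := fun hF =>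
    hF.bdd_mul (c := C) hφ.continuous.aestronglyMeasurable (ae_of_all _ hC)
  have hdcont : Continuous (fun x => fderiv ℝ φ x y) :=
    (hφ.continuous_fderiv (by simp)).clm_apply continuous_const
  obtain ⟨C', hC'⟩ :=
    (hφc.fderiv_apply (𝕜 := ℝ) y).exists_bound_of_continuous hdcont
  have hline : ∀ x, φ (x - y) - φ x = -∫ t in Set.Ioc (0 : ℝ) 1, fderiv ℝ φ (x - t • y) y := by
    intro x
    have hd : ∀ t : ℝ, HasDerivAt (fun t : ℝ => φ (x - t • y)) (-(fderiv ℝ φ (x - t • y) y)) t := by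
      intro t
      have h1 : HasDerivAt (fun t : ℝ => x - t • y) (-y) t := by
        simpa using ((hasDerivAt_id t).smul_const y).const_sub x
      have h2 := ((hφ.differentiable (by simp)) (x - t • y)).hasFDerivAt.comp_hasDerivAt t h1
      rw [map_neg] at h2
      exact h2
    have := intervalIntegral.integral_eq_sub_of_hasDerivAt (a := 0) (b := 1) (fun t _ => hd t)
      ((hdcont.comp (by fun_prop : Continuous fun t : ℝ => x - t • y)).neg.intervalIntegrable _ _)
    rw [intervalIntegral.integral_of_le zero_le_one, integral_neg] at this
    simpa using this.symm
  have hVD : Integrable (fun z : Plane × ℝ => V z.1 * fderiv ℝ φ (z.1 - z.2 • y) y)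
      (volume.prod (volume.restrict (Set.Ioc (0 : ℝ) 1))) := by
    refine (hVi.comp_fst _).mul_bdd (c := C') (Continuous.aestronglyMeasurable ?_)
      (ae_of_all _ fun z => hC' _)
    exact hdcont.comp (by fun_prop : Continuous fun z : Plane × ℝ => z.1 - z.2 • y)
  have hφG : Integrable (fun z : Plane × ℝ => φ z.1 * G (z.1 + z.2 • y))
      (volume.prod (volume.restrict (Set.Ioc (0 : ℝ) 1))) :=
    hGp.bdd_mul (c := C) (hφ.continuous.comp continuous_fst).aestronglyMeasurable
      (ae_of_all _ fun z => hC _)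
  have hweak : ∀ t ∈ Set.Ioc (0 : ℝ) 1,
      ∫ x, V x * fderiv ℝ φ (x - t • y) y = -∫ x, φ x * G (x + t • y) := by
    intro t ht
    -- The segment hypothesis enters here: it keeps the support of the translated test function
    -- inside `O`, so the weak gradient may be tested against it.
    have ht' : IsTestFunction O (fun x => φ (x - t • y)) :=
      hφt.comp_sub fun x hx => hy x hx t ⟨ht.1.le, ht.2⟩
    have hw := h.integral_fderiv hv hg ht' y
    simp_rw [fderiv_comp_sub] at hw
    rw [← integral_indicator hOm, ← integral_indicator hOm] at hw
    have e1 : ∀ x, O.indicator (fun x => v x * fderiv ℝ φ (x - t • y) y) x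
        = V x * fderiv ℝ φ (x - t • y) y := fun x => by
      rw [hV]; by_cases hx : x ∈ O <;> simp [hx]
    have e2 : ∀ x, O.indicator (fun x => inner ℝ (g x) y * φ (x - t • y)) x
        = G x * φ (x - t • y) := fun x => by
      rw [hG]; by_cases hx : x ∈ O <;> simp [hx]
    simp_rw [e1, e2] at hw
    rw [hw, ← integral_add_right_eq_self (μ := volume) (fun x => G x * φ (x - t • y)) (t • y)]
    simp_rw [add_sub_cancel_right, mul_comm]
  have key : (∫ x, φ x * V (x + y)) - ∫ x, φ x * V x
      = ∫ x, φ x * ∫ t in Set.Ioc (0 : ℝ) 1, G (x + t • y) := by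
    have s1 : ∫ x, φ x * V (x + y) = ∫ x, φ (x - y) * V x := by
      rw [← integral_add_right_eq_self (μ := volume) (fun x => φ (x - y) * V x) y]
      simp
    have hi : Integrable (fun x => φ (x - y) * V x) :=
      hVi.bdd_mul (c := C) (hφ.continuous.comp (continuous_sub_right y)).aestronglyMeasurable
        (ae_of_all _ fun x => hC _)
    rw [s1, ← integral_sub hi (hbd hVi)]
    calc ∫ x, (φ (x - y) * V x - φ x * V x)
        = -∫ x, ∫ t in Set.Ioc (0 : ℝ) 1, V x * fderiv ℝ φ (x - t • y) y := by
          rw [← integral_neg]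
          congr 1 with x
          rw [← sub_mul, hline, integral_const_mul]
          ring
      _ = -∫ t in Set.Ioc (0 : ℝ) 1, ∫ x, V x * fderiv ℝ φ (x - t • y) y := by
          rw [integral_integral_swap hVD]
      _ = ∫ t in Set.Ioc (0 : ℝ) 1, ∫ x, φ x * G (x + t • y) := by
          rw [setIntegral_congr_fun measurableSet_Ioc hweak, integral_neg, neg_neg]
      _ = ∫ x, ∫ t in Set.Ioc (0 : ℝ) 1, φ x * G (x + t • y) := by
          exact (integral_integral_swap hφG).symm
      _ = _ := by simp_rw [integral_const_mul]
  simp only [smul_eq_mul, mul_sub]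
  have i1 := hbd (hVi.comp_add_right y)
  have i2 := hbd hVi
  have i12 : Integrable (fun x => φ x * V (x + y) - φ x * V x) := i1.sub i2
  rw [integral_sub i12 (hbd hI), integral_sub i1 i2, key, sub_self]

/-! ### Estimates for cone averages of nonnegative functions on the plane. -/

/-- The `L²(ℝ²)`-norm of a nonnegative extended real function. -/
noncomputable def l2Norm (F : Plane → ℝ≥0∞) : ℝ≥0∞ := (∫⁻ x, F x ^ (2 : ℝ)) ^ (1 / 2 : ℝ)

/-- The Cauchy–Schwarz inequality for square roots of functions. -/
lemma lintegral_sqrt_mul_sqrt_le {α : Type*} [MeasurableSpace α] {μ : Measure α}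
    {f g : α → ℝ≥0∞} (hf : Measurable f) (hg : Measurable g) :
    ∫⁻ a, f a ^ (1 / 2 : ℝ) * g a ^ (1 / 2 : ℝ) ∂μ
      ≤ (∫⁻ a, f a ∂μ) ^ (1 / 2 : ℝ) * (∫⁻ a, g a ∂μ) ^ (1 / 2 : ℝ) := by
  have h := ENNReal.lintegral_mul_le_Lp_mul_Lq μ Real.HolderConjugate.two_two
    (hf.pow_const (1 / 2 : ℝ)).aemeasurable (hg.pow_const (1 / 2 : ℝ)).aemeasurable
  have e : ∀ a : ℝ≥0∞, (a ^ (1 / 2 : ℝ)) ^ (2 : ℝ) = a := fun a => by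
    rw [← ENNReal.rpow_mul]; norm_num
  simp only [e] at h
  exact h

lemma sqrt_sq_eq_self (a : ℝ≥0∞) : (a ^ (2 : ℝ)) ^ (1 / 2 : ℝ) = a := by
  rw [← ENNReal.rpow_mul]; norm_num

lemma lintegral_mul_le_l2Norm {X G : Plane → ℝ≥0∞} (hX : Measurable X) (hG : Measurable G) :
    ∫⁻ x, X x * G x ≤ l2Norm X * l2Norm G := by
  have h := lintegral_sqrt_mul_sqrt_le (μ := volume) (hX.pow_const (2 : ℝ)) (hG.pow_const (2 : ℝ))
  simpa only [sqrt_sq_eq_self, l2Norm] using h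

lemma l2Norm_comp_add (F : Plane → ℝ≥0∞) (a : Plane) : l2Norm (fun x => F (x + a)) = l2Norm F := by
  rw [l2Norm, l2Norm, lintegral_add_right_eq_self (fun x => F x ^ (2 : ℝ)) a]

lemma setLIntegral_le_sqrt {F : Plane → ℝ≥0∞} (hF : Measurable F) (B : Set Plane) :
    ∫⁻ y in B, F y ≤ (∫⁻ y in B, F y ^ (2 : ℝ)) ^ (1 / 2 : ℝ) * volume B ^ (1 / 2 : ℝ) := by
  have h := lintegral_sqrt_mul_sqrt_le (μ := volume.restrict B) (hF.pow_const (2 : ℝ))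
    (measurable_const (a := (1 : ℝ≥0∞)))
  simpa only [sqrt_sq_eq_self, ENNReal.one_rpow, mul_one, setLIntegral_one] using h

lemma lintegral_comp_smul_plane {F : Plane → ℝ≥0∞} (hF : Measurable F) {t : ℝ} (ht : 0 < t) :
    ∫⁻ y, F (t • y) = ENNReal.ofReal (t ^ 2)⁻¹ * ∫⁻ y, F y := by
  have h := lintegral_map (μ := (volume : Measure Plane)) hF (measurable_const_smul t)
  rw [Measure.map_addHaar_smul volume ht.ne', lintegral_smul_measure] at h
  rw [← h, finrank_euclideanSpace_fin, abs_of_pos (by positivity), smul_eq_mul]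

/-- The measure `dt / t` of the dilation factors which take a point into a ball avoiding the
origin is bounded. -/
lemma setLIntegral_inv_indicator_ball_le {p : Plane} {b : ℝ} (hb : 0 < b) (hbp : b < ‖p‖)
    {δ : ℝ} (hδ : 0 < δ) (w : Plane) :
    ∫⁻ t in Set.Ioc δ 1, ENNReal.ofReal t⁻¹ * (Metric.ball p b).indicator 1 (t⁻¹ • w)
      ≤ ENNReal.ofReal ((‖p‖ + b) / (‖p‖ - b)) := by
  set A := ‖p‖ + b with hA
  set a := ‖p‖ - b with ha
  have ha0 : 0 < a := by rw [ha]; linarith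
  have hA0 : 0 < A := by rw [hA]; linarith
  -- If `t⁻¹ • w` lies in the ball then `a < ‖w‖ / t < A`. This confines `t` to an interval of
  -- length `‖w‖ / a - ‖w‖ / A`, on which `t⁻¹ ≤ A / ‖w‖`; the product no longer involves the size
  -- of `w`.
  have hpt : ∀ t ∈ Set.Ioc δ 1,
      ENNReal.ofReal t⁻¹ * (Metric.ball p b).indicator 1 (t⁻¹ • w)
        ≤ (Set.Ioc (‖w‖ / A) (‖w‖ / a)).indicator (fun _ => ENNReal.ofReal (A / ‖w‖)) t := by
    intro t ht
    have ht0 : 0 < t := hδ.trans ht.1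
    by_cases hw : t⁻¹ • w ∈ Metric.ball p b
    · have h1 : ‖t⁻¹ • w - p‖ < b := by simpa [dist_eq_norm] using hw
      have h2 : ‖t⁻¹ • w‖ = ‖w‖ / t := by
        rw [norm_smul, norm_inv, Real.norm_of_nonneg ht0.le]; ring
      have h3 := abs_lt.1 ((abs_norm_sub_norm_le _ _).trans_lt h1)
      rw [h2] at h3
      have h4 : ‖w‖ < A * t := by rw [← div_lt_iff₀ ht0]; linarith [h3.2]
      have h5 : a * t < ‖w‖ := by rw [← lt_div_iff₀ ht0]; linarith [h3.1]
      have hw0 : 0 < ‖w‖ := lt_trans (by positivity) h5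
      have hmem : t ∈ Set.Ioc (‖w‖ / A) (‖w‖ / a) :=
        ⟨by rw [div_lt_iff₀ hA0]; linarith, by rw [le_div_iff₀ ha0]; linarith⟩
      rw [Set.indicator_of_mem hw, Set.indicator_of_mem hmem, Pi.one_apply, mul_one]
      apply ENNReal.ofReal_le_ofReal
      rw [inv_eq_one_div, div_le_div_iff₀ ht0 hw0]
      linarith
    · rw [Set.indicator_of_notMem hw, mul_zero]
      exact zero_le
  calc _ ≤ ∫⁻ t in Set.Ioc δ 1,
        (Set.Ioc (‖w‖ / A) (‖w‖ / a)).indicator (fun _ => ENNReal.ofReal (A / ‖w‖)) t :=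
        setLIntegral_mono' measurableSet_Ioc hpt
    _ ≤ ∫⁻ t, (Set.Ioc (‖w‖ / A) (‖w‖ / a)).indicator (fun _ => ENNReal.ofReal (A / ‖w‖)) t :=
        setLIntegral_le_lintegral _ _
    _ = ENNReal.ofReal (A / ‖w‖ * (‖w‖ / a - ‖w‖ / A)) := by
        rw [lintegral_indicator_const measurableSet_Ioc, Real.volume_Ioc,
          ENNReal.ofReal_mul (by positivity)]
    _ ≤ ENNReal.ofReal (A / a) := by
        apply ENNReal.ofReal_le_ofReal
        -- For `w = 0` the convention `A / 0 = 0` makes the left side vanish.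
        rcases (norm_nonneg w).eq_or_lt with h | h
        · rw [← h]; simp; positivity
        · have : A / ‖w‖ * (‖w‖ / a - ‖w‖ / A) = A / a - 1 := by field_simp
          linarith

/-- Substituting `w = t • y` in the plane produces the Jacobian `t⁻²`, which the weight `t` turns
into `t⁻¹`. After exchanging integrals, each `w` is weighted by the `dt / t` measure of the
dilations bringing it into the ball; this is bounded uniformly in `δ` because the ball stays away
from the origin. -/
lemma setLIntegral_mul_setLIntegral_ball_le {p : Plane} {b : ℝ} (hb : 0 < b) (hbp : b < ‖p‖)
    {δ : ℝ} (hδ : 0 < δ) {H : Plane → ℝ≥0∞} (hH : Measurable H) (x : Plane) :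
    ∫⁻ t in Set.Ioc δ 1, ENNReal.ofReal t * ∫⁻ y in Metric.ball p b, H (x + t • y)
      ≤ ENNReal.ofReal ((‖p‖ + b) / (‖p‖ - b)) * ∫⁻ z, H z := by
  set B := Metric.ball p b
  have hBm : MeasurableSet B := measurableSet_ball
  have h1m : Measurable (B.indicator (1 : Plane → ℝ≥0∞)) := measurable_one.indicator hBm
  have hsc : ∀ t ∈ Set.Ioc δ 1, ENNReal.ofReal t * ∫⁻ y in B, H (x + t • y)
      = ∫⁻ w, H (x + w) * (ENNReal.ofReal t⁻¹ * B.indicator 1 (t⁻¹ • w)) := by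
    intro t ht
    have ht0 : 0 < t := hδ.trans ht.1
    have hFm : Measurable fun w : Plane => H (x + w) * B.indicator 1 (t⁻¹ • w) :=
      (hH.comp (measurable_const_add x)).mul (h1m.comp (measurable_const_smul _))
    have h := lintegral_comp_smul_plane hFm ht0
    have e : ∫⁻ y in B, H (x + t • y) = ∫⁻ y, H (x + t • y) * B.indicator 1 (t⁻¹ • t • y) := by
      rw [← lintegral_indicator hBm]
      congr 1 with y
      rw [smul_smul, inv_mul_cancel₀ ht0.ne', one_smul]
      by_cases hy : y ∈ B <;> simp [hy]
    rw [e, h, ← mul_assoc, ← ENNReal.ofReal_mul ht0.le, ← lintegral_const_mul _ hFm]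
    have : t * (t ^ 2)⁻¹ = t⁻¹ := by field_simp
    rw [this]
    congr 1 with w
    ring
  rw [setLIntegral_congr_fun measurableSet_Ioc hsc, lintegral_lintegral_swap]
  · calc _ = ∫⁻ w, H (x + w) *
          ∫⁻ t in Set.Ioc δ 1, ENNReal.ofReal t⁻¹ * B.indicator 1 (t⁻¹ • w) := by
          congr 1 with w
          rw [lintegral_const_mul]
          exact (ENNReal.measurable_ofReal.comp measurable_inv).mul
            (h1m.comp (measurable_inv.smul_const w))
      _ ≤ ∫⁻ w, H (x + w) * ENNReal.ofReal ((‖p‖ + b) / (‖p‖ - b)) :=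
          lintegral_mono fun w => by
            gcongr
            exact setLIntegral_inv_indicator_ball_le hb hbp hδ w
      _ = _ := by
          rw [lintegral_add_left_eq_self (fun w => H w * _) x, lintegral_mul_const _ hH, mul_comm]
  · apply Measurable.aemeasurable
    refine (hH.comp (measurable_const.add measurable_snd)).mul
      ((ENNReal.measurable_ofReal.comp measurable_fst.inv).mul (h1m.comp ?_))
    exact measurable_fst.inv.smul measurable_snd

/-- The only source of the logarithm; Cauchy–Schwarz brings in its square root. -/
lemma setLIntegral_ofReal_inv {δ : ℝ} (hδ : 0 < δ) (hδ1 : δ ≤ 1) :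
    ∫⁻ t in Set.Ioc δ 1, ENNReal.ofReal t⁻¹ = ENNReal.ofReal (Real.log δ⁻¹) := by
  rw [← ofReal_integral_eq_lintegral_ofReal, ← intervalIntegral.integral_of_le hδ1,
    integral_inv_of_pos hδ one_pos, one_div]
  · rw [← IntegrableOn, ← intervalIntegrable_iff_integrableOn_Ioc_of_le hδ1]
    refine intervalIntegral.intervalIntegrable_inv (fun t ht => ?_) continuousOn_id
    rw [Set.uIcc_of_le hδ1] at ht
    exact (hδ.trans_le ht.1).ne'
  · filter_upwards [ae_restrict_mem measurableSet_Ioc] with t ht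
    exact inv_nonneg.2 (hδ.trans ht.1).le

/-- The pointwise logarithmic bound for the part of the cone average away from the vertex. -/
lemma setLIntegral_Ioc_setLIntegral_ball_le {p : Plane} {b : ℝ} (hb : 0 < b) (hbp : b < ‖p‖)
    {δ : ℝ} (hδ : 0 < δ) (hδ1 : δ ≤ 1) {G : Plane → ℝ≥0∞} (hG : Measurable G) (x : Plane) :
    ∫⁻ t in Set.Ioc δ 1, ∫⁻ y in Metric.ball p b, G (x + t • y)
      ≤ ENNReal.ofReal ((‖p‖ + b) / (‖p‖ - b)) ^ (1 / 2 : ℝ) * l2Norm G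
        * (ENNReal.ofReal (Real.log δ⁻¹) ^ (1 / 2 : ℝ)
          * volume (Metric.ball p b) ^ (1 / 2 : ℝ)) := by
  set B := Metric.ball p b
  have hG2 : Measurable fun z => G z ^ (2 : ℝ) := hG.pow_const _
  have hmeas : Measurable fun z : ℝ × Plane => G (x + z.1 • z.2) ^ (2 : ℝ) :=
    hG2.comp (measurable_const.add (measurable_fst.smul measurable_snd))
  -- The factors `t` and `t⁻¹` are inserted so that a second Cauchy–Schwarz, now in `t`, leaves a
  -- first factor bounded independently of `δ` and a second one equal to a power of `log δ⁻¹` times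
  -- one of `volume B`.
  have hpt : ∀ t ∈ Set.Ioc δ 1, ∫⁻ y in B, G (x + t • y)
      ≤ (ENNReal.ofReal t * ∫⁻ y in B, G (x + t • y) ^ (2 : ℝ)) ^ (1 / 2 : ℝ)
        * (ENNReal.ofReal t⁻¹ * volume B) ^ (1 / 2 : ℝ) := by
    intro t ht
    have ht0 : 0 < t := hδ.trans ht.1
    have hm : Measurable fun y : Plane => G (x + t • y) :=
      hG.comp (measurable_const.add (measurable_const_smul t))
    refine (setLIntegral_le_sqrt hm B).trans_eq ?_
    rw [← ENNReal.mul_rpow_of_nonneg _ _ (by norm_num),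
      ← ENNReal.mul_rpow_of_nonneg _ _ (by norm_num)]
    congr 1
    rw [mul_mul_mul_comm, ← ENNReal.ofReal_mul ht0.le, mul_inv_cancel₀ ht0.ne', ENNReal.ofReal_one,
      one_mul]
  refine (setLIntegral_mono' measurableSet_Ioc hpt).trans ?_
  refine (lintegral_sqrt_mul_sqrt_le
    (ENNReal.measurable_ofReal.mul hmeas.lintegral_prod_right')
    ((ENNReal.measurable_ofReal.comp measurable_inv).mul_const _)).trans ?_
  rw [lintegral_mul_const _ (ENNReal.measurable_ofReal.comp measurable_inv)]
  have e : ∫⁻ t in Set.Ioc δ 1, (ENNReal.ofReal ∘ Inv.inv) t = ENNReal.ofReal (Real.log δ⁻¹) :=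
    setLIntegral_ofReal_inv hδ hδ1
  rw [e, ENNReal.mul_rpow_of_nonneg _ (volume B) (by norm_num)]
  gcongr
  rw [l2Norm, ← ENNReal.mul_rpow_of_nonneg _ _ (by norm_num)]
  gcongr
  exact setLIntegral_mul_setLIntegral_ball_le hb hbp hδ hG2 x

/-- The bound for the part of the cone average close to the vertex, tested against `X`. -/
lemma lintegral_mul_setLIntegral_Ioc_le (B : Set Plane) {δ : ℝ}
    {X G : Plane → ℝ≥0∞} (hX : Measurable X) (hG : Measurable G) :
    ∫⁻ x, X x * ∫⁻ t in Set.Ioc 0 δ, ∫⁻ y in B, G (x + t • y)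
      ≤ ENNReal.ofReal δ * (volume B * (l2Norm X * l2Norm G)) := by
  have m3 : Measurable fun z : (Plane × ℝ) × Plane => X z.1.1 * G (z.1.1 + z.1.2 • z.2) :=
    (hX.comp (by fun_prop)).mul (hG.comp (by fun_prop))
  have m3' : Measurable fun z : (Plane × ℝ) × Plane => G (z.1.1 + z.1.2 • z.2) :=
    hG.comp (by fun_prop)
  have m2 : ∀ t : ℝ, Measurable fun z : Plane × Plane => X z.1 * G (z.1 + t • z.2) := fun t =>
    (hX.comp (by fun_prop)).mul (hG.comp (by fun_prop))
  have e1 : ∀ x, X x * ∫⁻ t in Set.Ioc 0 δ, ∫⁻ y in B, G (x + t • y)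
      = ∫⁻ t in Set.Ioc 0 δ, ∫⁻ y in B, X x * G (x + t • y) := by
    intro x
    have hm : Measurable fun t : ℝ => ∫⁻ y in B, G (x + t • y) :=
      (m3'.lintegral_prod_right' (ν := volume.restrict B)).comp (measurable_prodMk_left (x := x))
    rw [← lintegral_const_mul _ hm]
    congr 1 with t
    rw [lintegral_const_mul]
    exact hG.comp (by fun_prop)
  simp_rw [e1]
  rw [lintegral_lintegral_swap (m3.lintegral_prod_right' (ν := volume.restrict B)).aemeasurable]
  calc _ ≤ ∫⁻ t in Set.Ioc 0 δ, volume B * (l2Norm X * l2Norm G) := by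
        refine lintegral_mono fun t => ?_
        rw [lintegral_lintegral_swap (m2 t).aemeasurable]
        calc _ ≤ ∫⁻ y in B, l2Norm X * l2Norm G := by
              refine lintegral_mono fun y => ?_
              -- With `t` and `y` frozen, `G` is merely translated, so Cauchy–Schwarz in `x` loses
              -- nothing and the short range of `t` supplies the factor `δ`.
              rw [← l2Norm_comp_add G (t • y)]
              exact lintegral_mul_le_l2Norm hX (hG.comp (by fun_prop))
          _ = _ := by rw [setLIntegral_const, mul_comm]
    _ = _ := by rw [setLIntegral_const, Real.volume_Ioc, sub_zero, mul_comm]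

/-- Averaging a bound for differences along the directions in a ball. -/
lemma exists_le_of_forall_ball_le {p : Plane} {b : ℝ} (hb : 0 < b) (hbp : b < ‖p‖) :
    ∃ C : ℝ≥0∞, C ≠ ∞ ∧ ∀ (X V G : Plane → ℝ≥0∞), Measurable X → Measurable V → Measurable G →
      ∀ J : ℝ≥0∞, (∀ y ∈ Metric.ball p b, J ≤ (∫⁻ x, X x * V (x + y))
          + ENNReal.ofReal (‖p‖ + b) * ∫⁻ x, X x * ∫⁻ t in Set.Ioc (0 : ℝ) 1, G (x + t • y)) →
      ∀ δ : ℝ, 0 < δ → δ ≤ 1 →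
        J ≤ C * ((∫⁻ x, X x) * (l2Norm V + ENNReal.ofReal (Real.log δ⁻¹) ^ (1 / 2 : ℝ) * l2Norm G)
          + ENNReal.ofReal δ * (l2Norm X * l2Norm G)) := by
  set B := Metric.ball p b
  set β := volume B with hβ
  set A := ENNReal.ofReal (‖p‖ + b)
  set K := ENNReal.ofReal ((‖p‖ + b) / (‖p‖ - b))
  have hβ0 : β ≠ 0 := (Metric.measure_ball_pos volume p hb).ne'
  have hβt : β ≠ ∞ := measure_ball_lt_top.ne
  set D := β ^ (1 / 2 : ℝ) + A * β + A * (K ^ (1 / 2 : ℝ) * β ^ (1 / 2 : ℝ)) with hD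
  have hβr : β ^ (1 / 2 : ℝ) ≠ ∞ := ENNReal.rpow_ne_top_of_nonneg (by norm_num) hβt
  have hKr : K ^ (1 / 2 : ℝ) ≠ ∞ := ENNReal.rpow_ne_top_of_nonneg (by norm_num) ENNReal.ofReal_ne_top
  have hDt : D ≠ ∞ := by
    have hA : A ≠ ∞ := ENNReal.ofReal_ne_top
    finiteness
  -- The factor `β⁻¹` comes from averaging over the ball. The summands of `D` belong, in order, to
  -- the endpoint term, the gradient term for `t ≤ δ` and the gradient term for `t > δ`.
  refine ⟨β⁻¹ * D, ENNReal.mul_ne_top (ENNReal.inv_ne_top.2 hβ0) hDt, ?_⟩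
  intro X V G hX hV hG J hJ δ hδ hδ1
  set lg := ENNReal.ofReal (Real.log δ⁻¹) ^ (1 / 2 : ℝ)
  have mXV : Measurable fun z : Plane × Plane => X z.2 * V (z.2 + z.1) :=
    (hX.comp (by fun_prop)).mul (hV.comp (by fun_prop))
  have mG : ∀ x, Measurable fun z : Plane × ℝ => G (x + z.2 • z.1) := fun x => hG.comp (by fun_prop)
  have mG3 : Measurable fun z : (Plane × Plane) × ℝ => G (z.1.2 + z.2 • z.1.1) :=
    hG.comp (by fun_prop)
  have mXG : Measurable fun z : Plane × Plane =>
      X z.2 * ∫⁻ t in Set.Ioc (0 : ℝ) 1, G (z.2 + t • z.1) :=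
    (hX.comp measurable_snd).mul mG3.lintegral_prod_right'
  have main : β * J ≤ (∫⁻ y in B, ∫⁻ x, X x * V (x + y))
      + A * ∫⁻ y in B, ∫⁻ x, X x * ∫⁻ t in Set.Ioc (0 : ℝ) 1, G (x + t • y) := by
    rw [mul_comm, hβ, ← setLIntegral_const, ← lintegral_const_mul _ mXG.lintegral_prod_right',
      ← lintegral_add_left mXV.lintegral_prod_right']
    exact setLIntegral_mono' measurableSet_ball hJ
  have first : ∫⁻ y in B, ∫⁻ x, X x * V (x + y) ≤ (∫⁻ x, X x) * (l2Norm V * β ^ (1 / 2 : ℝ)) := by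
    rw [lintegral_lintegral_swap mXV.aemeasurable, ← lintegral_mul_const _ hX]
    refine lintegral_mono fun x => ?_
    have hVx : Measurable fun y : Plane => V (x + y) := hV.comp (by fun_prop)
    dsimp only
    rw [lintegral_const_mul _ hVx]
    gcongr
    refine (setLIntegral_le_sqrt hVx B).trans ?_
    gcongr
    rw [← l2Norm_comp_add V x, l2Norm]
    refine ENNReal.rpow_le_rpow ?_ (by norm_num)
    simp only [add_comm x]
    exact setLIntegral_le_lintegral _ _
  have second : ∫⁻ y in B, ∫⁻ x, X x * ∫⁻ t in Set.Ioc (0 : ℝ) 1, G (x + t • y)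
      ≤ ENNReal.ofReal δ * (β * (l2Norm X * l2Norm G))
        + (∫⁻ x, X x) * (K ^ (1 / 2 : ℝ) * l2Norm G * (lg * β ^ (1 / 2 : ℝ))) := by
    rw [lintegral_lintegral_swap mXG.aemeasurable, ← lintegral_mul_const _ hX]
    calc _ = ∫⁻ x, (X x * (∫⁻ t in Set.Ioc 0 δ, ∫⁻ y in B, G (x + t • y))
          + X x * ∫⁻ t in Set.Ioc δ 1, ∫⁻ y in B, G (x + t • y)) := by
          congr 1 with x
          rw [lintegral_const_mul _ (mG x).lintegral_prod_right',
            lintegral_lintegral_swap (mG x).aemeasurable, ← mul_add,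
            ← lintegral_union measurableSet_Ioc (Set.Ioc_disjoint_Ioc_of_le le_rfl),
            Set.Ioc_union_Ioc_eq_Ioc hδ.le hδ1]
      _ ≤ ∫⁻ x, (X x * (∫⁻ t in Set.Ioc 0 δ, ∫⁻ y in B, G (x + t • y))
          + X x * (K ^ (1 / 2 : ℝ) * l2Norm G * (lg * β ^ (1 / 2 : ℝ)))) := by
          refine lintegral_mono fun x => ?_
          dsimp only
          gcongr
          exact setLIntegral_Ioc_setLIntegral_ball_le hb hbp hδ hδ1 hG x
      _ ≤ _ := by
          rw [lintegral_add_right _ (hX.mul_const _)]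
          gcongr
          exact lintegral_mul_setLIntegral_Ioc_le B hX hG
  set I := ∫⁻ x, X x
  rw [mul_assoc, ← ENNReal.mul_le_iff_le_inv hβ0 hβt]
  refine main.trans ((add_le_add first (mul_le_mul_right second A)).trans ?_)
  have e : I * (l2Norm V * β ^ (1 / 2 : ℝ)) + A * (ENNReal.ofReal δ * (β * (l2Norm X * l2Norm G))
        + I * (K ^ (1 / 2 : ℝ) * l2Norm G * (lg * β ^ (1 / 2 : ℝ))))
      = β ^ (1 / 2 : ℝ) * (I * l2Norm V) + A * β * (ENNReal.ofReal δ * (l2Norm X * l2Norm G))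
        + A * (K ^ (1 / 2 : ℝ) * β ^ (1 / 2 : ℝ)) * (I * (lg * l2Norm G)) := by ring
  rw [e, hD, add_mul, add_mul]
  gcongr
  · exact (mul_le_mul_right le_self_add I).trans le_self_add
  · exact le_add_self
  · exact (mul_le_mul_right le_add_self I).trans le_self_add

/-! ### From cone averages to the pairing of `L²(O)` with `H¹(O)`. -/

/-- The integrated form of the fundamental theorem of calculus along segments of direction `y`. -/
lemma IsWeakGradient.setLIntegral_mul_le {O U : Set Plane} {v : Plane → ℝ} {g : Plane → Plane}
    (h : IsWeakGradient O v g) (hOm : MeasurableSet O)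
    (hvm : StronglyMeasurable v) (hgm : StronglyMeasurable g)
    (hv : IntegrableOn v O) (hg : IntegrableOn g O) (hU : IsOpen U) {y : Plane}
    (hy : ∀ x ∈ U, ∀ t ∈ Set.Icc (0 : ℝ) 1, x + t • y ∈ O) {M : ℝ} (hM : ‖y‖ ≤ M)
    {X : Plane → ℝ≥0∞} (hX : Measurable X) :
    ∫⁻ x in U, X x * ‖O.indicator v x‖ₑ ≤ (∫⁻ x, X x * ‖O.indicator v (x + y)‖ₑ)
      + ENNReal.ofReal M
        * ∫⁻ x, X x * ∫⁻ t in Set.Ioc (0 : ℝ) 1, ‖O.indicator g (x + t • y)‖ₑ := by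
  have hVm : Measurable fun x => ‖O.indicator v x‖ₑ := (hvm.indicator hOm).enorm
  have hGm : Measurable fun x => ‖O.indicator g x‖ₑ := (hgm.indicator hOm).enorm
  have hXV : Measurable fun x => X x * ‖O.indicator v (x + y)‖ₑ :=
    hX.mul (hVm.comp (measurable_add_const y))
  have hGp : Measurable fun z : Plane × ℝ => ‖O.indicator g (z.1 + z.2 • y)‖ₑ :=
    hGm.comp (by fun_prop : Measurable fun z : Plane × ℝ => z.1 + z.2 • y)
  have hXG : Measurable fun x =>
      X x * ∫⁻ t in Set.Ioc (0 : ℝ) 1, ‖O.indicator g (x + t • y)‖ₑ :=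
    hX.mul hGp.lintegral_prod_right'
  have hinner : ∀ z, ‖O.indicator (fun z => inner ℝ (g z) y) z‖ₑ
      ≤ ENNReal.ofReal M * ‖O.indicator g z‖ₑ := by
    intro z
    by_cases hz : z ∈ O
    · rw [Set.indicator_of_mem hz, Set.indicator_of_mem hz, ← ofReal_norm,
        ← ofReal_norm, ← ENNReal.ofReal_mul ((norm_nonneg y).trans hM), mul_comm]
      apply ENNReal.ofReal_le_ofReal
      exact (norm_inner_le_norm _ _).trans (by gcongr)
    · simp [hz]
  have hpt : ∀ᵐ x : Plane, x ∈ U → X x * ‖O.indicator v x‖ₑ ≤ X x * ‖O.indicator v (x + y)‖ₑ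
      + ENNReal.ofReal M
        * (X x * ∫⁻ t in Set.Ioc (0 : ℝ) 1, ‖O.indicator g (x + t • y)‖ₑ) := by
    filter_upwards [h.ae_add_sub_eq hOm hgm hv hg hU hy] with x hx hxU
    have e : O.indicator v x = O.indicator v (x + y)
        - ∫ t in Set.Ioc (0 : ℝ) 1, O.indicator (fun z => inner ℝ (g z) y) (x + t • y) := by
      linarith [hx hxU]
    have hle : ‖O.indicator v x‖ₑ ≤ ‖O.indicator v (x + y)‖ₑ
        + ENNReal.ofReal M * ∫⁻ t in Set.Ioc (0 : ℝ) 1, ‖O.indicator g (x + t • y)‖ₑ := by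
      rw [e]
      refine enorm_sub_le.trans ?_
      gcongr
      refine (enorm_integral_le_lintegral_enorm _).trans ?_
      rw [← lintegral_const_mul' _ _ ENNReal.ofReal_ne_top]
      exact lintegral_mono fun t => hinner _
    calc _ ≤ X x * (‖O.indicator v (x + y)‖ₑ
        + ENNReal.ofReal M * ∫⁻ t in Set.Ioc (0 : ℝ) 1, ‖O.indicator g (x + t • y)‖ₑ) := by
          gcongr
      _ = _ := by ring
  calc _ ≤ ∫⁻ x in U, (X x * ‖O.indicator v (x + y)‖ₑ + ENNReal.ofReal M
        * (X x * ∫⁻ t in Set.Ioc (0 : ℝ) 1, ‖O.indicator g (x + t • y)‖ₑ)) :=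
        setLIntegral_mono_ae' hU.measurableSet hpt
    _ ≤ ∫⁻ x, (X x * ‖O.indicator v (x + y)‖ₑ + ENNReal.ofReal M
        * (X x * ∫⁻ t in Set.Ioc (0 : ℝ) 1, ‖O.indicator g (x + t • y)‖ₑ)) :=
        setLIntegral_le_lintegral _ _
    _ = _ := by rw [lintegral_add_left hXV, lintegral_const_mul _ hXG]

/-- Extension by zero carries norms on `O` over to the plane, where translations and dilations act.
-/
lemma l2Norm_enorm_indicator {E : Type*} [NormedAddCommGroup E] {O : Set Plane}
    (hOm : MeasurableSet O) (f : Lp E 2 (volume.restrict O)) :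
    l2Norm (fun x => ‖O.indicator f x‖ₑ) = ‖f‖ₑ := by
  rw [Lp.enorm_def, eLpNorm_eq_lintegral_rpow_enorm_toReal (by norm_num) (by norm_num), l2Norm]
  norm_num
  congr 1
  rw [← lintegral_indicator hOm]
  congr 1 with x
  by_cases hx : x ∈ O <;> simp [hx]

/-- The pairing of `L²(O)` with `H¹(O)`, with a free cut-off scale `δ`. -/
lemma IsSmoothBoundedOpen.exists_lintegral_mul_le {O : Set Plane} (hO : IsSmoothBoundedOpen O) :
    ∃ C : ℝ≥0∞, C ≠ ∞ ∧ ∀ (ξ : L2 O), ∀ q ∈ H1 O, ∀ δ : ℝ, 0 < δ → δ ≤ 1 →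
      ∫⁻ x in O, ‖ξ x‖ₑ * ‖q.fst x‖ₑ
        ≤ C * ((∫⁻ x in O, ‖ξ x‖ₑ)
            * (‖q.fst‖ₑ + ENNReal.ofReal (Real.log δ⁻¹) ^ (1 / 2 : ℝ) * ‖q.snd‖ₑ)
          + ENNReal.ofReal δ * (‖ξ‖ₑ * ‖q.snd‖ₑ)) := by
  have hOm : MeasurableSet O := hO.isOpen.measurableSet
  have : IsFiniteMeasure (volume.restrict O) := ⟨by
    rw [Measure.restrict_apply_univ]; exact hO.isBounded.measure_lt_top⟩
  -- Writing the domain as `O ∩ closure O` lets the second set vary in the compactness induction: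
  -- the estimate passes to subsets, adds constants under unions, and holds near each point of the
  -- closure by the cone condition.
  suffices hS : ∃ C : ℝ≥0∞, C ≠ ∞ ∧ ∀ (ξ : L2 O), ∀ q ∈ H1 O, ∀ δ : ℝ, 0 < δ → δ ≤ 1 →
      ∫⁻ x in O ∩ closure O, ‖ξ x‖ₑ * ‖q.fst x‖ₑ
        ≤ C * ((∫⁻ x in O, ‖ξ x‖ₑ)
            * (‖q.fst‖ₑ + ENNReal.ofReal (Real.log δ⁻¹) ^ (1 / 2 : ℝ) * ‖q.snd‖ₑ)
          + ENNReal.ofReal δ * (‖ξ‖ₑ * ‖q.snd‖ₑ)) by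
    rwa [Set.inter_eq_left.2 subset_closure] at hS
  refine hO.isBounded.isCompact_closure.induction_on ⟨0, by simp, by simp⟩ ?_ ?_ ?_
  · rintro s t hst ⟨C, hC, h⟩
    refine ⟨C, hC, fun ξ q hq δ hδ hδ1 => le_trans ?_ (h ξ q hq δ hδ hδ1)⟩
    exact lintegral_mono_set (Set.inter_subset_inter_right O hst)
  · rintro s t ⟨C, hC, h⟩ ⟨C', hC', h'⟩
    refine ⟨C + C', ENNReal.add_ne_top.2 ⟨hC, hC'⟩, fun ξ q hq δ hδ hδ1 => ?_⟩
    rw [Set.inter_union_distrib_left, add_mul]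
    exact (lintegral_union_le _ _ _).trans
      (add_le_add (h ξ q hq δ hδ hδ1) (h' ξ q hq δ hδ hδ1))
  · intro x₀ hx₀
    obtain ⟨ρ, p, b, hρ, hb, hbp, hcone⟩ := hO.exists_cone hx₀
    refine ⟨Metric.ball x₀ ρ, mem_nhdsWithin_of_mem_nhds (Metric.ball_mem_nhds x₀ hρ), ?_⟩
    obtain ⟨C, hC, h⟩ := exists_le_of_forall_ball_le hb hbp
    refine ⟨C, hC, fun ξ q hq δ hδ hδ1 => ?_⟩
    set U := O ∩ Metric.ball x₀ ρ with hU
    have hUo : IsOpen U := hO.isOpen.inter Metric.isOpen_ball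
    have hξm : Measurable fun x => ‖O.indicator ξ x‖ₑ :=
      ((Lp.stronglyMeasurable ξ).indicator hOm).enorm
    have hvm : Measurable fun x => ‖O.indicator q.fst x‖ₑ :=
      ((Lp.stronglyMeasurable q.fst).indicator hOm).enorm
    have hgm : Measurable fun x => ‖O.indicator q.snd x‖ₑ :=
      ((Lp.stronglyMeasurable q.snd).indicator hOm).enorm
    have hres := h _ _ _ hξm hvm hgm
      (∫⁻ x in U, ‖O.indicator ξ x‖ₑ * ‖O.indicator q.fst x‖ₑ) ?_ δ hδ hδ1
    · simp only [l2Norm_enorm_indicator hOm] at hres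
      have e1 : ∫⁻ x, ‖O.indicator ξ x‖ₑ = ∫⁻ x in O, ‖ξ x‖ₑ := by
        rw [← lintegral_indicator hOm]
        congr 1 with x
        by_cases hx : x ∈ O <;> simp [hx]
      have e2 : ∫⁻ x in U, ‖O.indicator ξ x‖ₑ * ‖O.indicator q.fst x‖ₑ
          = ∫⁻ x in U, ‖ξ x‖ₑ * ‖q.fst x‖ₑ :=
        setLIntegral_congr_fun hUo.measurableSet fun x hx => by
          simp only [Set.indicator_of_mem hx.1]
      rwa [e1, e2] at hres
    · intro y hy
      have hyM : ‖y‖ ≤ ‖p‖ + b := by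
        have h1 : ‖y - p‖ < b := by simpa [dist_eq_norm] using hy
        have h2 := norm_sub_norm_le y p
        linarith
      exact IsWeakGradient.setLIntegral_mul_le hq hOm (Lp.stronglyMeasurable q.fst)
        (Lp.stronglyMeasurable q.snd) ((Lp.memLp q.fst).integrable (by norm_num))
        ((Lp.memLp q.snd).integrable (by norm_num)) hUo (fun x hx t ht => hcone x hx y hy t ht)
        hyM hξm

/-! ### Choice of the cut-off scale and conclusion. -/

theorem lemmaA1 (O : Set Plane) (hO : IsSmoothBoundedOpen O) :
    ∃ c : ℝ, 0 < c ∧ ∀ ξ : L2 O,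
      ‖L2.toH1Dual ξ‖ ≤
        c * (1 + (∫ x in O, |ξ x|) * Real.sqrt (Real.log (Real.exp 1 + ‖ξ‖))) := by
  obtain ⟨C, hC, h⟩ := hO.exists_lintegral_mul_le
  have : IsFiniteMeasure (volume.restrict O) := ⟨by
    rw [Measure.restrict_apply_univ]; exact hO.isBounded.measure_lt_top⟩
  refine ⟨2 * C.toReal + 1, by positivity, fun ξ => ?_⟩
  set I := ∫ x in O, |ξ x| with hI
  set R := Real.exp 1 + ‖ξ‖ with hR
  set s := Real.sqrt (Real.log R) with hs
  have hI0 : 0 ≤ I := integral_nonneg fun x => abs_nonneg _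
  have hs0 : 0 ≤ s := Real.sqrt_nonneg _
  have hRe : Real.exp 1 ≤ R := le_add_of_nonneg_right (norm_nonneg ξ)
  have hR0 : 0 < R := (Real.exp_pos 1).trans_le hRe
  have hR1 : 1 ≤ R := (Real.one_le_exp zero_le_one).trans hRe
  have hlog : 1 ≤ Real.log R := by rwa [Real.le_log_iff_exp_le hR0]
  have hs1 : 1 ≤ s := by rw [hs]; exact Real.one_le_sqrt.2 hlog
  refine ContinuousLinearMap.opNorm_le_bound _ (by positivity) fun q => ?_
  set v := q.1.fst with hv
  set g := q.1.snd with hg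
  have hqn : ‖v‖ ^ 2 + ‖g‖ ^ 2 = ‖q‖ ^ 2 := (WithLp.prod_norm_sq_eq_of_L2 q.1).symm
  have hvq : ‖v‖ ≤ ‖q‖ := abs_le_of_sq_le_sq' (by nlinarith [sq_nonneg ‖g‖]) (norm_nonneg _) |>.2
  have hgq : ‖g‖ ≤ ‖q‖ := abs_le_of_sq_le_sq' (by nlinarith [sq_nonneg ‖v‖]) (norm_nonneg _) |>.2
  -- The scale `δ = R⁻¹` turns `log δ⁻¹` into `log R` and gives `δ * ‖ξ‖ ≤ 1`. Since `R ≥ e`, also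
  -- `s ≥ 1`, so the term with `‖v‖` is absorbed into `s * ‖q‖`.
  have hmain := h ξ q.1 q.2 R⁻¹ (by positivity) (inv_le_one_of_one_le₀ hR1)
  rw [inv_inv] at hmain
  have hIe : ∫⁻ x in O, ‖ξ x‖ₑ = ENNReal.ofReal I :=
    (ofReal_integral_norm_eq_lintegral_enorm ((Lp.memLp ξ).integrable (by norm_num))).symm
  have hse : ENNReal.ofReal (Real.log R) ^ (1 / 2 : ℝ) = ENNReal.ofReal s := by
    rw [ENNReal.ofReal_rpow_of_nonneg (by linarith) (by norm_num), hs, Real.sqrt_eq_rpow]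
  have hrhs : C * ((∫⁻ x in O, ‖ξ x‖ₑ)
            * (‖v‖ₑ + ENNReal.ofReal (Real.log R) ^ (1 / 2 : ℝ) * ‖g‖ₑ)
          + ENNReal.ofReal R⁻¹ * (‖ξ‖ₑ * ‖g‖ₑ))
      = ENNReal.ofReal (C.toReal * (I * (‖v‖ + s * ‖g‖) + R⁻¹ * (‖ξ‖ * ‖g‖))) := by
    rw [hIe, hse, ← ofReal_norm, ← ofReal_norm, ← ofReal_norm,
      ENNReal.ofReal_mul ENNReal.toReal_nonneg, ENNReal.ofReal_toReal hC,
      ENNReal.ofReal_add (by positivity) (by positivity), ENNReal.ofReal_mul hI0,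
      ENNReal.ofReal_add (by positivity) (by positivity), ENNReal.ofReal_mul hs0,
      ENNReal.ofReal_mul (by positivity), ENNReal.ofReal_mul (norm_nonneg _)]
  have happ : ‖L2.toH1Dual ξ q‖ₑ ≤ ∫⁻ x in O, ‖ξ x‖ₑ * ‖v x‖ₑ := by
    have e : L2.toH1Dual ξ q = ∫ x in O, inner ℝ (ξ x) (v x) := L2.inner_def ξ v
    rw [e]
    refine (enorm_integral_le_lintegral_enorm _).trans (lintegral_mono fun x => ?_)
    rw [Real.inner_apply, enorm_mul]
  have hfin := happ.trans (hmain.trans_eq hrhs)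
  rw [← ofReal_norm, ENNReal.ofReal_le_ofReal_iff (by positivity)] at hfin
  have hC0 : 0 ≤ C.toReal := ENNReal.toReal_nonneg
  have hq0 := norm_nonneg q
  have h1 : ‖v‖ + s * ‖g‖ ≤ 2 * s * ‖q‖ := by
    have := mul_le_mul_of_nonneg_left hgq hs0
    nlinarith
  have h2 : R⁻¹ * (‖ξ‖ * ‖g‖) ≤ ‖q‖ := by
    have : R⁻¹ * ‖ξ‖ ≤ 1 := by
      rw [inv_mul_le_iff₀ hR0, hR]; linarith [Real.exp_pos 1]
    calc R⁻¹ * (‖ξ‖ * ‖g‖) = (R⁻¹ * ‖ξ‖) * ‖g‖ := by ring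
      _ ≤ 1 * ‖q‖ := by gcongr
      _ = ‖q‖ := one_mul _
  calc ‖L2.toH1Dual ξ q‖ ≤ C.toReal * (I * (‖v‖ + s * ‖g‖) + R⁻¹ * (‖ξ‖ * ‖g‖)) := hfin
    _ ≤ C.toReal * (I * (2 * s * ‖q‖) + ‖q‖) := by gcongr
    -- Slack is added so that the sum factors as `(2C + 1)(1 + I s)‖q‖`; the extra `1` keeps the
    -- constant positive even if `C = 0`.
    _ ≤ C.toReal * (I * (2 * s * ‖q‖) + 2 * ‖q‖) + (1 + I * s) * ‖q‖ := by
        have : 0 ≤ (1 + I * s) * ‖q‖ := by positivity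
        nlinarith
    _ = _ := by ring
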